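/- Let $\mathcal I\subset SO(3)$ be the icosahedral group, i.e. the group of all rotations leaving a regular icosahedron centred at the origin invariant, and let $B_6=O(6)\cap GL(6,\mathbb Z)$ be the hyperoctahedral group of all $6\times 6$ orthogonal matrices with integer entries. A real representation of a group is called crystallographic if its character takes integer values and it is reducible and contains a two- or three-dimensional irreducible (real) representation. An orthogonal crystallographic representation of $\mathcal I$ is a homomorphism $\rho:\mathcal I\to B_6$ that is crystallographic as a representation on $\mathbb R^6$; a subgroup $\mathcal H\le B_6$ is called an orthogonal crystallographic representation of $\mathcal I$ if it is the image of an isomorphism $\mathcal I\to\mathcal H$ that is one when regarded as a homomorphism $\mathcal I\to B_6$. Any two orthogonal crystallographic representations of $\mathcal I$ are equivalent in $B_6$. That is: 1. if $\rho_1,\rho_2:\mathcal I\to B_6$ are orthogonal crystallographic representations of $\mathcal I$, then there is $M\in B_6$ with $\rho_1(g)=M\rho_2(g)M^{-1}$ for all $g\in\mathcal I$; 2. if the subgroups $\mathcal H_1,\mathcal H_2\le B_6$ are orthogonal crystallographic representations of $\mathcal I$, then there is $M\in B_6$ with $\mathcal H_1=M\mathcal H_2M^{-1}$. -/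

import Mathlib

open scoped Matrix

noncomputable section

namespace Icosahedral

/-- The twelve vertices `(0, ±1, ±τ)`, `(±1, ±τ, 0)`, `(±τ, 0, ±1)` of a regular icosahedron
centred at the origin, with `τ` the golden ratio. -/
def vertices : Set (Fin 3 → ℝ) :=
  {v | ∃ a b : ℝ, (a = 1 ∨ a = -1) ∧ (b = Real.goldenRatio ∨ b = -Real.goldenRatio) ∧
    (v = ![0, a, b] ∨ v = ![a, b, 0] ∨ v = ![b, 0, a])}

/-- The icosahedral group: all rotations of three-dimensional space that leave the regular
icosahedron invariant, that is, that map its set of vertices onto itself. -/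
def icosahedralGroup : Subgroup (Matrix.specialOrthogonalGroup (Fin 3) ℝ) where
  carrier := {A | (fun v : Fin 3 → ℝ => A.1 *ᵥ v) '' vertices = vertices}
  one_mem' := by simp
  mul_mem' := by
    intro A B hA hB
    simp only [Set.mem_ofPred_eq] at hA hB ⊢
    conv_rhs => rw [← hA, ← hB, Set.image_image]
    simp [Matrix.mulVec_mulVec]
  inv_mem' := by
    intro A hA
    simp only [Set.mem_ofPred_eq] at hA ⊢
    have h : (A⁻¹).1 * A.1 = 1 := congrArg Subtype.val (inv_mul_cancel A)
    conv_lhs => rw [← hA, Set.image_image]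
    simp [Matrix.mulVec_mulVec, h]

/-- The hyperoctahedral group `B_n`: all `n × n` orthogonal matrices with integer entries. -/
abbrev hyperoctahedralGroup (n : ℕ) : Submonoid (Matrix (Fin n) (Fin n) ℤ) :=
  Matrix.orthogonalGroup (Fin n) ℤ

/-- The real `n`-dimensional representation afforded by a homomorphism `G → B_n`: each `g` acts on
column vectors in `ℝⁿ` by multiplication with its matrix. -/
def realRep {G : Type*} [Group G] {n : ℕ} (ρ : G →* hyperoctahedralGroup n) :
    Representation ℝ G (Fin n → ℝ) where
  toFun g := Matrix.toLin' ((ρ g).1.map (fun k : ℤ => (k : ℝ)))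
  map_one' := by simp [Module.End.one_eq_id]
  map_mul' g h := by
    have h1 : ((ρ g).1 * (ρ h).1).map (fun k : ℤ => (k : ℝ)) =
        (ρ g).1.map (fun k : ℤ => (k : ℝ)) * (ρ h).1.map (fun k : ℤ => (k : ℝ)) :=
      Matrix.map_mul (f := Int.castRingHom ℝ)
    rw [map_mul, Submonoid.coe_mul, h1, Matrix.toLin'_mul]
    rfl

/-- A real representation is crystallographic if its character takes integer values, and it is
reducible and contains a two- or three-dimensional irreducible representation. -/
def IsCrystallographic {G V : Type*} [Group G] [AddCommGroup V] [Module ℝ V]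
    (ρ : Representation ℝ G V) : Prop :=
  (∀ g : G, ∃ k : ℤ, ρ.character g = (k : ℝ)) ∧
  ¬ ρ.IsIrreducible ∧
  ∃ W : Subrepresentation ρ,
    (Module.finrank ℝ W.toSubmodule = 2 ∨ Module.finrank ℝ W.toSubmodule = 3) ∧
    W.toRepresentation.IsIrreducible

/-- A subgroup of `B_6` is a crystallographic representation of the icosahedral group if it is
isomorphic to that group and the resulting representation on `ℝ⁶` is crystallographic. -/
def IsCrystallographicSubgroup (H : Subgroup (hyperoctahedralGroup 6)) : Prop :=
  ∃ e : icosahedralGroup ≃* H, IsCrystallographic (realRep (H.subtype.comp e.toMonoidHom))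

end Icosahedral

end

/-! ### Two generating rotations of the icosahedral group and their relations -/

namespace Icosahedral

open Real goldenRatio

/-! The group `icosahedralGroup` is generated by a rotation S of order 5 and a half turn T with S^5
= T^2 = (ST)^3 = 1, so a homomorphism to B_6 is determined by the images of S and T. These images
satisfy the same relations, and elements of B_6 are signed permutations, so the possible pairs can
be classified up to simultaneous conjugacy.

If S maps to 1, so does T, and the action is trivial. Otherwise S can be conjugated to an unsigned
5-cycle, and the relations leave three normal forms for T (`isConjPair_normalForm`). Two are
unsigned permutation representations: A_5 on five letters plus a fixed letter (1 + 1 + 4), and the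
transitive action on six letters (1 + 5). Neither they nor the trivial action have an irreducible
subspace of dimension 2 or 3 (`finrank_of_intransitive`, `finrank_of_transitive`,
`IsMinimalStable.finrank_le_one`). So every crystallographic representation has the one remaining,
genuinely signed form, and any two are conjugate in B_6. Conjugacy of image subgroups follows. -/

theorem mem_vertices_iff {v : Fin 3 → ℝ} : v ∈ vertices ↔
    v = ![0, 1, φ] ∨ v = ![0, 1, -φ] ∨ v = ![0, -1, φ] ∨ v = ![0, -1, -φ] ∨
    v = ![1, φ, 0] ∨ v = ![1, -φ, 0] ∨ v = ![-1, φ, 0] ∨ v = ![-1, -φ, 0] ∨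
    v = ![φ, 0, 1] ∨ v = ![φ, 0, -1] ∨ v = ![-φ, 0, 1] ∨ v = ![-φ, 0, -1] := by
  constructor
  · rintro ⟨a, b, rfl | rfl, rfl | rfl, rfl | rfl | rfl⟩ <;> simp
  · rintro (rfl | rfl | rfl | rfl | rfl | rfl | rfl | rfl | rfl | rfl | rfl | rfl)
    · exact ⟨1, φ, by simp⟩
    · exact ⟨1, -φ, by simp⟩
    · exact ⟨-1, φ, by simp⟩
    · exact ⟨-1, -φ, by simp⟩
    · exact ⟨1, φ, by simp⟩
    · exact ⟨1, -φ, by simp⟩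
    · exact ⟨-1, φ, by simp⟩
    · exact ⟨-1, -φ, by simp⟩
    · exact ⟨1, φ, by simp⟩
    · exact ⟨-1, φ, by simp⟩
    · exact ⟨1, -φ, by simp⟩
    · exact ⟨-1, -φ, by simp⟩

/-- The matrix of the rotation by `2π/5` about the vertex `(0, 1, τ)`. -/
noncomputable def fiveFoldMatrix : Matrix (Fin 3) (Fin 3) ℝ :=
  !![(φ - 1) / 2, -φ / 2, 1 / 2; φ / 2, 1 / 2, (φ - 1) / 2; -1 / 2, (φ - 1) / 2, φ / 2]

/-- The matrix of the half turn about the `z`-axis. -/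
noncomputable def twoFoldMatrix : Matrix (Fin 3) (Fin 3) ℝ := !![-1, 0, 0; 0, -1, 0; 0, 0, 1]

theorem fiveFoldMatrix_mulVec (x y z : ℝ) : fiveFoldMatrix *ᵥ ![x, y, z] =
    ![((φ - 1) * x - φ * y + z) / 2, (φ * x + y + (φ - 1) * z) / 2,
      (-x + (φ - 1) * y + φ * z) / 2] := by
  ext i; fin_cases i <;> simp [fiveFoldMatrix, Matrix.mulVec, dotProduct, Fin.sum_univ_three] <;> ring

theorem twoFoldMatrix_mulVec (x y z : ℝ) : twoFoldMatrix *ᵥ ![x, y, z] = ![-x, -y, z] := by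
  ext i; fin_cases i <;> simp [twoFoldMatrix, Matrix.mulVec, dotProduct, Fin.sum_univ_three]

theorem vec_three_eq {a b c a' b' c' : ℝ} (ha : a = a') (hb : b = b') (hc : c = c') :
    ![a, b, c] = ![a', b', c'] := by rw [ha, hb, hc]

theorem fiveFoldMatrix_mulVec_vertices :
    fiveFoldMatrix *ᵥ ![0, 1, φ] = ![0, 1, φ] ∧ fiveFoldMatrix *ᵥ ![0, 1, -φ] = ![-φ, 0, -1] ∧
    fiveFoldMatrix *ᵥ ![0, -1, φ] = ![φ, 0, 1] ∧ fiveFoldMatrix *ᵥ ![0, -1, -φ] = ![0, -1, -φ] ∧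
    fiveFoldMatrix *ᵥ ![1, φ, 0] = ![-1, φ, 0] ∧ fiveFoldMatrix *ᵥ ![1, -φ, 0] = ![φ, 0, -1] ∧
    fiveFoldMatrix *ᵥ ![-1, φ, 0] = ![-φ, 0, 1] ∧ fiveFoldMatrix *ᵥ ![-1, -φ, 0] = ![1, -φ, 0] ∧
    fiveFoldMatrix *ᵥ ![φ, 0, 1] = ![1, φ, 0] ∧ fiveFoldMatrix *ᵥ ![φ, 0, -1] = ![0, 1, -φ] ∧
    fiveFoldMatrix *ᵥ ![-φ, 0, 1] = ![0, -1, φ] ∧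
    fiveFoldMatrix *ᵥ ![-φ, 0, -1] = ![-1, -φ, 0] := by
  have h : φ ^ 2 = φ + 1 := goldenRatio_sq
  simp only [fiveFoldMatrix_mulVec]
  refine ⟨?_, ?_, ?_, ?_, ?_, ?_, ?_, ?_, ?_, ?_, ?_, ?_⟩ <;> apply vec_three_eq <;> linarith

theorem fiveFoldMatrix_mulVec_mem {v : Fin 3 → ℝ} (hv : v ∈ vertices) :
    fiveFoldMatrix *ᵥ v ∈ vertices := by
  obtain ⟨h1, h2, h3, h4, h5, h6, h7, h8, h9, h10, h11, h12⟩ := fiveFoldMatrix_mulVec_vertices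
  rcases mem_vertices_iff.1 hv with
    rfl | rfl | rfl | rfl | rfl | rfl | rfl | rfl | rfl | rfl | rfl | rfl <;>
  simp only [h1, h2, h3, h4, h5, h6, h7, h8, h9, h10, h11, h12] <;> simp [mem_vertices_iff]

theorem twoFoldMatrix_mulVec_mem {v : Fin 3 → ℝ} (hv : v ∈ vertices) :
    twoFoldMatrix *ᵥ v ∈ vertices := by
  rcases mem_vertices_iff.1 hv with
    rfl | rfl | rfl | rfl | rfl | rfl | rfl | rfl | rfl | rfl | rfl | rfl <;>
  simp [twoFoldMatrix_mulVec, mem_vertices_iff]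

theorem fiveFoldMatrix_sq : fiveFoldMatrix ^ 2 =
    !![-φ / 2, -1 / 2, (φ - 1) / 2; 1 / 2, (1 - φ) / 2, φ / 2; (1 - φ) / 2, φ / 2, 1 / 2] := by
  have h : φ ^ 2 = φ + 1 := goldenRatio_sq
  ext i j
  fin_cases i <;> fin_cases j <;>
    simp [pow_two, fiveFoldMatrix, Matrix.mul_apply, Fin.sum_univ_three] <;> linarith

/-- For an orthogonal matrix this amounts to fifth power one, and the entries to be compared remain
quadratic in φ. -/
theorem fiveFoldMatrix_pow_four : fiveFoldMatrix ^ 4 = fiveFoldMatrixᵀ := by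
  have h : φ ^ 2 = φ + 1 := goldenRatio_sq
  rw [show 4 = 2 * 2 from rfl, pow_mul, fiveFoldMatrix_sq]
  ext i j
  fin_cases i <;> fin_cases j <;>
    simp [pow_two, fiveFoldMatrix, Matrix.mul_apply, Fin.sum_univ_three] <;> linarith

theorem fiveFoldMatrix_mul_transpose : fiveFoldMatrix * fiveFoldMatrixᵀ = 1 := by
  have h : φ ^ 2 = φ + 1 := goldenRatio_sq
  ext i j
  fin_cases i <;> fin_cases j <;>
    simp [fiveFoldMatrix, Matrix.mul_apply, Fin.sum_univ_three] <;> linarith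

theorem fiveFoldMatrix_pow_five : fiveFoldMatrix ^ 5 = 1 := by
  rw [pow_succ', fiveFoldMatrix_pow_four, fiveFoldMatrix_mul_transpose]

theorem twoFoldMatrix_sq : twoFoldMatrix ^ 2 = 1 := by
  ext i j
  fin_cases i <;> fin_cases j <;>
    simp [pow_two, twoFoldMatrix, Matrix.mul_apply, Fin.sum_univ_three]

theorem fiveFoldMatrix_mul_twoFoldMatrix_pow_three : (fiveFoldMatrix * twoFoldMatrix) ^ 3 = 1 := by
  have h : φ ^ 2 = φ + 1 := goldenRatio_sq
  have h1 : fiveFoldMatrix * twoFoldMatrix =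
      !![(1 - φ) / 2, φ / 2, 1 / 2; -φ / 2, -1 / 2, (φ - 1) / 2;
        1 / 2, (1 - φ) / 2, φ / 2] := by
    ext i j
    fin_cases i <;> fin_cases j <;>
      simp [fiveFoldMatrix, twoFoldMatrix, Matrix.mul_apply, Fin.sum_univ_three] <;> linarith
  have h2 : (fiveFoldMatrix * twoFoldMatrix) ^ 2 = (fiveFoldMatrix * twoFoldMatrix)ᵀ := by
    rw [h1]
    ext i j
    fin_cases i <;> fin_cases j <;>
      simp [pow_two, Matrix.mul_apply, Fin.sum_univ_three] <;> linarith
  rw [pow_succ', h2, h1]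
  ext i j
  fin_cases i <;> fin_cases j <;>
    simp [Matrix.mul_apply, Fin.sum_univ_three] <;> linarith

/-- The inverse of A is the power `A ^ n`, which also preserves the vertices; hence inclusion
already gives equality. -/
theorem image_vertices_eq_of_pow_eq_one {A : Matrix (Fin 3) (Fin 3) ℝ} {n : ℕ}
    (hA : A ^ (n + 1) = 1) (h : ∀ v ∈ vertices, A *ᵥ v ∈ vertices) :
    (fun v : Fin 3 → ℝ => A *ᵥ v) '' vertices = vertices := by
  have hpow : ∀ m : ℕ, ∀ v ∈ vertices, (A ^ m) *ᵥ v ∈ vertices := by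
    intro m
    induction m with
    | zero => simp
    | succ m ih =>
      intro v hv
      rw [pow_succ', ← Matrix.mulVec_mulVec]
      exact h _ (ih v hv)
  apply Set.Subset.antisymm
  · rintro _ ⟨v, hv, rfl⟩
    exact h v hv
  · intro v hv
    refine ⟨(A ^ n) *ᵥ v, hpow n v hv, ?_⟩
    simp [Matrix.mulVec_mulVec, ← pow_succ', hA]

/-- The rotation by `2π/5` about the vertex `(0, 1, τ)`. -/
noncomputable def fiveFold : icosahedralGroup :=
  ⟨⟨fiveFoldMatrix, by
    rw [Matrix.mem_specialOrthogonalGroup_iff]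
    refine ⟨(Matrix.mem_orthogonalGroup_iff _ _).2 fiveFoldMatrix_mul_transpose, ?_⟩
    have h : φ ^ 2 = φ + 1 := goldenRatio_sq
    simp [fiveFoldMatrix, Matrix.det_fin_three]
    have h3 : φ ^ 3 = 2 * φ + 1 := by linear_combination (φ + 1) * h
    linarith⟩,
  image_vertices_eq_of_pow_eq_one (n := 4) fiveFoldMatrix_pow_five
    fun _ hv => fiveFoldMatrix_mulVec_mem hv⟩

/-- The half turn about the `z`-axis. -/
noncomputable def twoFold : icosahedralGroup :=
  ⟨⟨twoFoldMatrix, by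
    rw [Matrix.mem_specialOrthogonalGroup_iff]
    refine ⟨(Matrix.mem_orthogonalGroup_iff _ _).2 ?_, by simp [twoFoldMatrix, Matrix.det_fin_three]⟩
    ext i j
    fin_cases i <;> fin_cases j <;>
      simp [twoFoldMatrix, Matrix.mul_apply, Fin.sum_univ_three]⟩,
  image_vertices_eq_of_pow_eq_one (n := 1) twoFoldMatrix_sq
    fun _ hv => twoFoldMatrix_mulVec_mem hv⟩

theorem fiveFold_pow_five : fiveFold ^ 5 = 1 :=
  Subtype.ext (Subtype.ext fiveFoldMatrix_pow_five)

theorem twoFold_sq : twoFold ^ 2 = 1 :=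
  Subtype.ext (Subtype.ext twoFoldMatrix_sq)

theorem fiveFold_mul_twoFold_pow_three : (fiveFold * twoFold) ^ 3 = 1 :=
  Subtype.ext (Subtype.ext fiveFoldMatrix_mul_twoFoldMatrix_pow_three)

/-! ### Generation, through the action on pairs of adjacent vertices -/

theorem icosahedralGroup_mulVec_mem (g : icosahedralGroup) {v : Fin 3 → ℝ} (hv : v ∈ vertices) :
    g.1.1 *ᵥ v ∈ vertices := by
  have h : (fun v : Fin 3 → ℝ => g.1.1 *ᵥ v) '' vertices = vertices := g.2
  rw [← h]
  exact ⟨v, hv, rfl⟩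

theorem icosahedralGroup_mul_mulVec (g h : icosahedralGroup) (v : Fin 3 → ℝ) :
    (g * h).1.1 *ᵥ v = g.1.1 *ᵥ (h.1.1 *ᵥ v) := by
  rw [Matrix.mulVec_mulVec]; rfl

theorem icosahedralGroup_one_mulVec (v : Fin 3 → ℝ) :
    (1 : icosahedralGroup).1.1 *ᵥ v = v :=
  Matrix.one_mulVec v

theorem icosahedralGroup_inv_mulVec {g : icosahedralGroup} {v w : Fin 3 → ℝ}
    (h : g.1.1 *ᵥ v = w) : g⁻¹.1.1 *ᵥ w = v := by
  rw [← h, ← icosahedralGroup_mul_mulVec, inv_mul_cancel, icosahedralGroup_one_mulVec]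

/-- The five-fold rotation fixes (0, 1, φ) and its antipode and permutes the other ten vertices in
two 5-cycles; the half turn links these four orbits. -/
theorem exists_mem_closure_mulVec_eq {v : Fin 3 → ℝ} (hv : v ∈ vertices) :
    ∃ h ∈ Subgroup.closure {fiveFold, twoFold}, h.1.1 *ᵥ ![0, 1, φ] = v := by
  set R : (Fin 3 → ℝ) → Prop := fun v =>
    ∃ h ∈ Subgroup.closure {fiveFold, twoFold}, h.1.1 *ᵥ ![0, 1, φ] = v with hR
  have hs : ∀ {v w}, R v → fiveFoldMatrix *ᵥ v = w → R w := by
    rintro v w ⟨h, hh, rfl⟩ rfl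
    exact ⟨fiveFold * h, mul_mem (Subgroup.subset_closure (by simp)) hh,
      icosahedralGroup_mul_mulVec _ _ _⟩
  have ht : ∀ {x y z x' y'}, R ![x, y, z] → -x = x' → -y = y' → R ![x', y', z] := by
    rintro x y z x' y' ⟨h, hh, he⟩ rfl rfl
    refine ⟨twoFold * h, mul_mem (Subgroup.subset_closure (by simp)) hh, ?_⟩
    rw [icosahedralGroup_mul_mulVec, he]
    exact twoFoldMatrix_mulVec _ _ _
  obtain ⟨-, h2, h3, -, h5, h6, h7, h8, h9, h10, h11, -⟩ := fiveFoldMatrix_mulVec_vertices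
  have r1 : R ![0, 1, φ] := ⟨1, one_mem _, icosahedralGroup_one_mulVec _⟩
  have r3 : R ![0, -1, φ] := ht r1 (by simp) rfl
  have r9 : R ![φ, 0, 1] := hs r3 h3
  have r5 : R ![1, φ, 0] := hs r9 h9
  have r7 : R ![-1, φ, 0] := hs r5 h5
  have r11 : R ![-φ, 0, 1] := hs r7 h7
  have r8 : R ![-1, -φ, 0] := ht r5 (by simp) rfl
  have r6 : R ![1, -φ, 0] := hs r8 h8
  have r10 : R ![φ, 0, -1] := hs r6 h6
  have r2 : R ![0, 1, -φ] := hs r10 h10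
  have r12 : R ![-φ, 0, -1] := ht r10 rfl (by simp)
  have r4 : R ![0, -1, -φ] := ht r2 (by simp) rfl
  rcases mem_vertices_iff.1 hv with
    rfl | rfl | rfl | rfl | rfl | rfl | rfl | rfl | rfl | rfl | rfl | rfl <;> assumption

theorem icosahedralGroup_dotProduct_mulVec (g : icosahedralGroup) (v w : Fin 3 → ℝ) :
    (g.1.1 *ᵥ v) ⬝ᵥ (g.1.1 *ᵥ w) = v ⬝ᵥ w := by
  have h : g.1.1ᵀ * g.1.1 = 1 :=
    (Matrix.mem_orthogonalGroup_iff' _ _).1 (Matrix.mem_specialOrthogonalGroup_iff.1 g.1.2).1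
  rw [Matrix.dotProduct_mulVec, ← Matrix.mulVec_transpose, Matrix.mulVec_mulVec, h,
    Matrix.one_mulVec]

/-- Inner product φ singles out the five neighbours of (0, 1, φ), which the powers of the five-fold
rotation permute cyclically. -/
theorem exists_mem_closure_fixing_mulVec_eq {v : Fin 3 → ℝ} (hv : v ∈ vertices)
    (hd : ![0, 1, φ] ⬝ᵥ v = φ) :
    ∃ h ∈ Subgroup.closure {fiveFold, twoFold}, h.1.1 *ᵥ ![0, 1, φ] = ![0, 1, φ] ∧
      h.1.1 *ᵥ ![0, -1, φ] = v := by
  set R : (Fin 3 → ℝ) → Prop := fun v =>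
    ∃ h ∈ Subgroup.closure {fiveFold, twoFold}, h.1.1 *ᵥ ![0, 1, φ] = ![0, 1, φ] ∧
      h.1.1 *ᵥ ![0, -1, φ] = v with hR
  obtain ⟨h1, -, h3, -, h5, -, h7, -, h9, -, -, -⟩ := fiveFoldMatrix_mulVec_vertices
  have hs : ∀ {v w}, R v → fiveFoldMatrix *ᵥ v = w → R w := by
    rintro v w ⟨h, hh, he, rfl⟩ rfl
    refine ⟨fiveFold * h, mul_mem (Subgroup.subset_closure (by simp)) hh, ?_,
      icosahedralGroup_mul_mulVec _ _ _⟩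
    rw [icosahedralGroup_mul_mulVec, he]
    exact h1
  have r3 : R ![0, -1, φ] :=
    ⟨1, one_mem _, icosahedralGroup_one_mulVec _, icosahedralGroup_one_mulVec _⟩
  have r9 : R ![φ, 0, 1] := hs r3 h3
  have r5 : R ![1, φ, 0] := hs r9 h9
  have r7 : R ![-1, φ, 0] := hs r5 h5
  have r11 : R ![-φ, 0, 1] := hs r7 h7
  have h : φ ^ 2 = φ + 1 := goldenRatio_sq
  have hp : 1 < φ := one_lt_goldenRatio
  rcases mem_vertices_iff.1 hv with
    rfl | rfl | rfl | rfl | rfl | rfl | rfl | rfl | rfl | rfl | rfl | rfl <;>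
  first
  | assumption
  | (exfalso
     simp [dotProduct, Fin.sum_univ_three] at hd
     nlinarith)

/-- The two fixed vectors span the yz-plane, so the last two columns are those of the identity;
orthogonality and determinant 1 then determine the first. -/
theorem icosahedralGroup_eq_one {g : icosahedralGroup}
    (h0 : g.1.1 *ᵥ ![0, 1, φ] = ![0, 1, φ]) (h1 : g.1.1 *ᵥ ![0, -1, φ] = ![0, -1, φ]) :
    g = 1 := by
  obtain ⟨⟨A, hA⟩, hg⟩ := g
  simp only at h0 h1
  rw [Matrix.mem_specialOrthogonalGroup_iff] at hA
  have ho : Aᵀ * A = 1 := (Matrix.mem_orthogonalGroup_iff' _ _).1 hA.1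
  have hφ : φ ≠ 0 := goldenRatio_ne_zero
  have e (i : Fin 3) := congrFun h0 i
  have f (i : Fin 3) := congrFun h1 i
  simp only [Matrix.mulVec, dotProduct, Fin.sum_univ_three] at e f
  have c1 : ∀ i, A i 1 = (1 : Matrix (Fin 3) (Fin 3) ℝ) i 1 := by
    intro i
    have he := e i
    have hf := f i
    fin_cases i <;> simp [Matrix.one_apply] at he hf ⊢ <;> linarith
  have c2 : ∀ i, A i 2 = (1 : Matrix (Fin 3) (Fin 3) ℝ) i 2 := by
    intro i
    apply mul_right_cancel₀ hφ
    have he := e i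
    have hf := f i
    fin_cases i <;> simp [Matrix.one_apply, -mul_eq_zero] at he hf ⊢ <;> linarith
  have o1 := congrFun (congrFun ho 1) 0
  have o2 := congrFun (congrFun ho 2) 0
  have hd := hA.2
  simp [Matrix.mul_apply, Fin.sum_univ_three, c1, c2] at o1 o2
  simp [Matrix.det_fin_three, c1, c2] at hd
  apply Subtype.ext
  apply Subtype.ext
  change A = 1
  ext i j
  fin_cases j
  · fin_cases i <;> simp [o1, o2, hd]
  · exact c1 i
  · exact c2 i

/-- The subgroup generated reaches every image of the pair (vertex, adjacent vertex), and a rotation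
is determined by what it does to this pair. -/
theorem closure_fiveFold_twoFold : Subgroup.closure {fiveFold, twoFold} = ⊤ := by
  rw [eq_top_iff]
  intro g _
  have m0 : (![0, 1, φ] : Fin 3 → ℝ) ∈ vertices := by simp [mem_vertices_iff]
  have m1 : (![0, -1, φ] : Fin 3 → ℝ) ∈ vertices := by simp [mem_vertices_iff]
  obtain ⟨h, hh, hv⟩ := exists_mem_closure_mulVec_eq (icosahedralGroup_mulVec_mem g m0)
  have hfix : (h⁻¹ * g).1.1 *ᵥ ![0, 1, φ] = ![0, 1, φ] := by
    rw [icosahedralGroup_mul_mulVec]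
    exact icosahedralGroup_inv_mulVec hv
  have hd : ![0, 1, φ] ⬝ᵥ ((h⁻¹ * g).1.1 *ᵥ ![0, -1, φ]) = φ := by
    have := icosahedralGroup_dotProduct_mulVec (h⁻¹ * g) ![0, 1, φ] ![0, -1, φ]
    rw [hfix] at this
    rw [this]
    have h : φ ^ 2 = φ + 1 := goldenRatio_sq
    simp [dotProduct, Fin.sum_univ_three]
    linarith
  obtain ⟨k, hk, hk0, hk1⟩ :=
    exists_mem_closure_fixing_mulVec_eq (icosahedralGroup_mulVec_mem (h⁻¹ * g) m1) hd
  have h1 : k⁻¹ * (h⁻¹ * g) = 1 := by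
    apply icosahedralGroup_eq_one
    · rw [icosahedralGroup_mul_mulVec, hfix]
      exact icosahedralGroup_inv_mulVec hk0
    · rw [icosahedralGroup_mul_mulVec]
      exact icosahedralGroup_inv_mulVec hk1
  have h2 : g = h * k := by
    rw [inv_mul_eq_one] at h1
    rw [h1, mul_inv_cancel_left]
  rw [h2]
  exact mul_mem hh hk

end Icosahedral

/-! ### Elements of B_n as signed permutations -/

namespace Icosahedral

open Equiv

/-- The element of `B_n` that maps the basis vector `e_j` to `ε j • e_{p j}`. -/
def signedPerm {n : ℕ} (p : Perm (Fin n)) (ε : Fin n → ℤˣ) : hyperoctahedralGroup n :=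
  ⟨Matrix.of fun i j => if i = p j then (ε j : ℤ) else 0, by
    rw [Matrix.mem_orthogonalGroup_iff']
    ext i j
    rcases eq_or_ne i j with rfl | h
    · simp [Matrix.mul_apply]
    · simp [Matrix.mul_apply, h, h.symm]⟩

theorem signedPerm_apply {n : ℕ} (p : Perm (Fin n)) (ε : Fin n → ℤˣ) (i j : Fin n) :
    (signedPerm p ε).1 i j = if i = p j then (ε j : ℤ) else 0 := rfl

theorem signedPerm_mul {n : ℕ} (p q : Perm (Fin n)) (ε δ : Fin n → ℤˣ) :
    signedPerm p ε * signedPerm q δ = signedPerm (p * q) fun j => ε (q j) * δ j := by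
  apply Subtype.ext
  ext i j
  rw [Submonoid.coe_mul, Matrix.mul_apply, signedPerm_apply]
  simp only [signedPerm_apply, mul_ite, mul_zero, Finset.sum_ite_eq', Finset.mem_univ, if_true,
    ite_mul, zero_mul, Units.val_mul]
  by_cases h : i = p (q j)
  · rw [if_pos h, if_pos (show i = (p * q) j from h)]
  · rw [if_neg h, if_neg (show ¬i = (p * q) j from h)]

theorem signedPerm_one {n : ℕ} : signedPerm (1 : Perm (Fin n)) 1 = 1 := by
  apply Subtype.ext
  ext i j
  rw [signedPerm_apply, OneMemClass.coe_one, Matrix.one_apply]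
  by_cases h : i = j
  · rw [if_pos h, if_pos (show i = (1 : Perm (Fin n)) j from h)]
    rfl
  · rw [if_neg h, if_neg (show ¬i = (1 : Perm (Fin n)) j from h)]

theorem signedPerm_inj {n : ℕ} {p q : Perm (Fin n)} {ε δ : Fin n → ℤˣ}
    (h : signedPerm p ε = signedPerm q δ) : p = q ∧ ε = δ := by
  have key : ∀ j, p j = q j ∧ ε j = δ j := by
    intro j
    have h1 : (signedPerm p ε).1 (p j) j = (signedPerm q δ).1 (p j) j := by rw [h]
    rw [signedPerm_apply, signedPerm_apply, if_pos rfl] at h1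
    split_ifs at h1 with h2
    · exact ⟨h2, Units.ext h1⟩
    · exact absurd h1 (Units.ne_zero _)
  exact ⟨Equiv.ext fun j => (key j).1, funext fun j => (key j).2⟩

theorem signedPerm_eq_one_iff {n : ℕ} {p : Perm (Fin n)} {ε : Fin n → ℤˣ} :
    signedPerm p ε = 1 ↔ p = 1 ∧ ε = 1 := by
  constructor
  · intro h
    rw [← signedPerm_one] at h
    exact signedPerm_inj h
  · rintro ⟨rfl, rfl⟩
    exact signedPerm_one

/-- An integer column with sum of squares 1 has a single nonzero entry, equal to ±1. Orthogonality
of distinct columns puts these entries in distinct rows. -/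
theorem exists_eq_signedPerm {n : ℕ} (A : hyperoctahedralGroup n) :
    ∃ p ε, A = signedPerm p ε := by
  obtain ⟨A, hA⟩ := A
  have h1 := (Matrix.mem_orthogonalGroup_iff' _ _).1 hA
  have hsum : ∀ j, ∑ i, A i j * A i j = 1 := by
    intro j
    have := congrFun (congrFun h1 j) j
    simpa [Matrix.mul_apply] using this
  have horth : ∀ j k, j ≠ k → ∑ i, A i j * A i k = 0 := by
    intro j k hjk
    have := congrFun (congrFun h1 j) k
    simpa [Matrix.mul_apply, hjk] using this
  have hex : ∀ j, ∃ i, A i j ≠ 0 := by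
    intro j
    by_contra! h
    have := hsum j
    simp [h] at this
  choose f hf using hex
  have hsplit : ∀ j, A (f j) j * A (f j) j = 1 ∧ ∀ i, i ≠ f j → A i j = 0 := by
    intro j
    have h2 := Finset.add_sum_erase Finset.univ (fun i => A i j * A i j) (Finset.mem_univ (f j))
    simp only [hsum j] at h2
    have h3 : 0 ≤ ∑ i ∈ Finset.univ.erase (f j), A i j * A i j :=
      Finset.sum_nonneg fun i _ => mul_self_nonneg _
    have h4 : 0 < A (f j) j * A (f j) j := mul_self_pos.2 (hf j)
    have h5 : ∑ i ∈ Finset.univ.erase (f j), A i j * A i j = 0 := by omega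
    refine ⟨by omega, fun i hi => ?_⟩
    have := (Finset.sum_eq_zero_iff_of_nonneg fun i _ => mul_self_nonneg (A i j)).1 h5 i
      (Finset.mem_erase.2 ⟨hi, Finset.mem_univ i⟩)
    exact mul_self_eq_zero.1 this
  have hinj : Function.Injective f := by
    intro j k hjk
    by_contra hne
    have h2 := horth j k hne
    rw [Finset.sum_eq_single (f j) (fun i _ hi => by rw [(hsplit j).2 i hi, zero_mul])
      (fun h => absurd (Finset.mem_univ _) h)] at h2
    rcases mul_eq_zero.1 h2 with h3 | h3
    · exact hf j h3
    · exact hf k (hjk ▸ h3)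
  refine ⟨Equiv.ofBijective f (Finite.injective_iff_bijective.1 hinj),
    fun j => ⟨A (f j) j, A (f j) j, (hsplit j).1, (hsplit j).1⟩, Subtype.ext ?_⟩
  ext i j
  rw [signedPerm_apply, Equiv.ofBijective_apply]
  split_ifs with h
  · rw [h]
  · exact (hsplit j).2 i h

/-! ### Finite classification of the permutations and signs -/

/-- The `5`-cycle `(0 1 2 3 4)` on six letters. -/
def fiveCycle : Perm (Fin 6) := c[0, 1, 2, 3, 4]

/-- A product of two transpositions that fixes the letter `5`. -/
def intransitiveInvolution : Perm (Fin 6) := c[0, 4] * c[2, 3]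

/-- A product of two transpositions that moves the letter `5`. -/
def transitiveInvolution : Perm (Fin 6) := c[0, 5] * c[1, 4]

theorem exists_conj_eq_fiveCycle {p : Perm (Fin 6)} (h5 : p ^ 5 = 1) (h1 : p ≠ 1) :
    ∃ q : Perm (Fin 6), q * p = fiveCycle * q := by
  have key : ∀ r : Perm (Fin 6), r ^ 5 = 1 → r ≠ 1 → r.cycleType = {5} := by
    intro r hr hr1
    have : Fact (Nat.Prime 5) := ⟨by norm_num⟩
    have ho : orderOf r = 5 := orderOf_eq_prime hr hr1
    obtain ⟨n, hn⟩ := Perm.cycleType_prime_order (ho ▸ (by norm_num : Nat.Prime 5))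
    rw [ho] at hn
    -- The cycle type consists of n + 1 fives; six letters have room for only one.
    have hs : r.cycleType.sum ≤ 6 := by
      rw [Perm.sum_cycleType]
      exact (Finset.card_le_univ _).trans (by simp)
    rw [hn, Multiset.sum_replicate] at hs
    have : n = 0 := by simp at hs; omega
    rw [hn, this]
    rfl
  have hc : IsConj p fiveCycle := by
    rw [Perm.isConj_iff_cycleType_eq, key p h5 h1, key fiveCycle (by decide +kernel) (by decide)]
  obtain ⟨q, hq⟩ := isConj_iff.1 hc
  exact ⟨q, by rw [← hq]; group⟩

/-- The hypotheses are the relations on the permutation underlying T. The conjugating elements are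
powers of the 5-cycle, so that the normal form of S is kept. -/
theorem involution_classification : ∀ p : Perm (Fin 6), p * p = 1 →
    fiveCycle * p * (fiveCycle * p) * (fiveCycle * p) = 1 →
    ∃ r ∈ [1, fiveCycle, fiveCycle ^ 2, fiveCycle ^ 3, fiveCycle ^ 4],
      r * p = intransitiveInvolution * r ∨ r * p = transitiveInvolution * r := by
  decide +kernel

/-- The hypothesis says that the signs around the cycle multiply to 1 and that the sign at the fixed
letter is 1. The signs are then a coboundary, removable by conjugation with a diagonal matrix. -/
theorem fiveCycle_gauge : ∀ ε : Fin 6 → ℤˣ,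
    (∀ j, ε ((fiveCycle * (fiveCycle * (fiveCycle * fiveCycle))) j) *
      (ε ((fiveCycle * (fiveCycle * fiveCycle)) j) * (ε ((fiveCycle * fiveCycle) j) *
      (ε (fiveCycle j) * ε j))) = 1) →
    ∃ δ : Fin 6 → ℤˣ, ∀ j, δ (fiveCycle j) * ε j = δ j := by
  decide +kernel

theorem intransitive_signs : ∀ ε : Fin 6 → ℤˣ,
    (∀ j, ε (intransitiveInvolution j) * ε j = 1) →
    (∀ j, ε ((fiveCycle * intransitiveInvolution * (fiveCycle * intransitiveInvolution)) j) *
      (ε ((fiveCycle * intransitiveInvolution) j) * ε j) = 1) → ∀ j, ε j = 1 := by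
  decide +kernel

/-- The signs of the monomial matrix in the crystallographic representation. -/
def crystallographicSigns : Fin 6 → ℤˣ := ![1, 1, -1, -1, 1, 1]

/-- The change of sign of the last coordinate. -/
def lastSign : Fin 6 → ℤˣ := ![1, 1, 1, 1, 1, -1]

/-- Conjugation by `lastSign`, which commutes with the unsigned 5-cycle, identifies the remaining
sign choices in pairs. -/
theorem transitive_signs : ∀ ε : Fin 6 → ℤˣ,
    (∀ j, ε (transitiveInvolution j) * ε j = 1) →
    (∀ j, ε ((fiveCycle * transitiveInvolution * (fiveCycle * transitiveInvolution)) j) *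
      (ε ((fiveCycle * transitiveInvolution) j) * ε j) = 1) →
    ((∀ j, ε j = 1) ∨ ∀ j, ε j = crystallographicSigns j) ∨
    ((∀ j, lastSign (transitiveInvolution j) * ε j = lastSign j) ∨
      ∀ j, lastSign (transitiveInvolution j) * ε j = crystallographicSigns j * lastSign j) := by
  decide +kernel

/-! ### Normal forms of generating pairs in B_6 -/

/-- The pair `(S, T)` is conjugate in the group to the pair `(S', T')`. -/
def IsConjPair {G : Type*} [Group G] (S T S' T' : G) : Prop :=
  ∃ M : G, M * S = S' * M ∧ M * T = T' * M

theorem IsConjPair.refl {G : Type*} [Group G] (S T : G) : IsConjPair S T S T :=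
  ⟨1, by simp, by simp⟩

theorem IsConjPair.trans {G : Type*} [Group G] {S T S' T' S'' T'' : G}
    (h : IsConjPair S T S' T') (h' : IsConjPair S' T' S'' T'') : IsConjPair S T S'' T'' := by
  obtain ⟨M, h1, h2⟩ := h
  obtain ⟨N, h3, h4⟩ := h'
  exact ⟨N * M, by rw [mul_assoc, h1, ← mul_assoc, h3, mul_assoc],
    by rw [mul_assoc, h2, ← mul_assoc, h4, mul_assoc]⟩

theorem IsConjPair.symm {G : Type*} [Group G] {S T S' T' : G}
    (h : IsConjPair S T S' T') : IsConjPair S' T' S T := by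
  obtain ⟨M, h1, h2⟩ := h
  refine ⟨M⁻¹, ?_, ?_⟩
  · rw [inv_mul_eq_iff_eq_mul, ← mul_assoc, h1, mul_inv_cancel_right]
  · rw [inv_mul_eq_iff_eq_mul, ← mul_assoc, h2, mul_inv_cancel_right]

theorem isConjPair_conj {G : Type*} [Group G] (M S T : G) :
    IsConjPair S T (M * S * M⁻¹) (M * T * M⁻¹) :=
  ⟨M, by group, by group⟩

/-- The relations between a rotation by `2π/5` and a half turn which generate the icosahedral
group. -/
structure IcosahedralRelations {G : Type*} [Group G] (S T : G) : Prop where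
  pow_five : S ^ 5 = 1
  sq : T ^ 2 = 1
  mul_pow_three : (S * T) ^ 3 = 1

theorem IcosahedralRelations.conj {G : Type*} [Group G] {S T : G}
    (h : IcosahedralRelations S T) (M : G) :
    IcosahedralRelations (M * S * M⁻¹) (M * T * M⁻¹) where
  pow_five := by rw [conj_pow, h.pow_five, mul_one, mul_inv_cancel]
  sq := by rw [conj_pow, h.sq, mul_one, mul_inv_cancel]
  mul_pow_three := by
    rw [show M * S * M⁻¹ * (M * T * M⁻¹) = M * (S * T) * M⁻¹ by group, conj_pow,
      h.mul_pow_three, mul_one, mul_inv_cancel]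

/-- A diagonal sign matrix with fifth power 1 is trivial, so the underlying permutation has order 5.
A permutation matrix conjugates it to the standard cycle, then a diagonal matrix clears the signs.
-/
theorem exists_conj_eq_signedPerm_fiveCycle {S : hyperoctahedralGroup 6} (h5 : S ^ 5 = 1)
    (h1 : S ≠ 1) : ∃ M : hyperoctahedralGroup 6, M * S * M⁻¹ = signedPerm fiveCycle 1 := by
  obtain ⟨p, ε, rfl⟩ := exists_eq_signedPerm S
  have hpow := h5
  simp only [pow_succ', pow_zero, mul_one, signedPerm_mul, signedPerm_eq_one_iff] at hpow
  obtain ⟨hp, hε⟩ := hpow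
  have hp1 : p ≠ 1 := by
    rintro rfl
    apply h1
    refine signedPerm_eq_one_iff.2 ⟨rfl, funext fun j => ?_⟩
    have hj := congrFun hε j
    simp only [Perm.mul_apply, Perm.one_apply, Pi.one_apply] at hj
    rcases Int.units_eq_one_or (ε j) with h | h
    · exact h
    · rw [h] at hj
      exact absurd hj (by decide)
  obtain ⟨q, hq⟩ := exists_conj_eq_fiveCycle (p := p) (by simpa [pow_succ'] using hp) hp1
  have hconj : signedPerm q 1 * signedPerm p ε * (signedPerm q 1)⁻¹ =
      signedPerm fiveCycle fun j => ε (q⁻¹ j) := by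
    rw [mul_inv_eq_iff_eq_mul, signedPerm_mul, signedPerm_mul, hq]
    congr 1
    funext j
    simp
  have h5' : (signedPerm fiveCycle fun j => ε (q⁻¹ j)) ^ 5 = 1 := by
    rw [← hconj, conj_pow, h5, mul_one, mul_inv_cancel]
  simp only [pow_succ', pow_zero, mul_one, signedPerm_mul, signedPerm_eq_one_iff] at h5'
  obtain ⟨δ, hδ⟩ := fiveCycle_gauge (fun j => ε (q⁻¹ j)) (fun j => congrFun h5'.2 j)
  refine ⟨signedPerm 1 δ * signedPerm q 1, ?_⟩
  have : signedPerm 1 δ * signedPerm q 1 * signedPerm p ε * (signedPerm 1 δ * signedPerm q 1)⁻¹ =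
      signedPerm 1 δ * (signedPerm q 1 * signedPerm p ε * (signedPerm q 1)⁻¹) *
        (signedPerm 1 δ)⁻¹ := by group
  rw [this, hconj, mul_inv_eq_iff_eq_mul, signedPerm_mul, signedPerm_mul, one_mul, mul_one]
  congr 1
  funext j
  simpa using hδ j

/-- Once S is an unsigned 5-cycle, T is simplified using only matrices that commute with S: powers
of the cycle for its permutation, then `lastSign` for its signs. -/
theorem isConjPair_normalForm {S T : hyperoctahedralGroup 6} (h : IcosahedralRelations S T)
    (h1 : S ≠ 1) :
    IsConjPair S T (signedPerm fiveCycle 1) (signedPerm intransitiveInvolution 1) ∨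
    IsConjPair S T (signedPerm fiveCycle 1) (signedPerm transitiveInvolution 1) ∨
    IsConjPair S T (signedPerm fiveCycle 1)
      (signedPerm transitiveInvolution crystallographicSigns) := by
  obtain ⟨M, hM⟩ := exists_conj_eq_signedPerm_fiveCycle h.pow_five h1
  have hc := isConjPair_conj M S T
  have hr := h.conj M
  rw [hM] at hc hr
  generalize M * T * M⁻¹ = T' at hc hr
  suffices hs : _ ∨ _ ∨ _ from hs.imp hc.trans (Or.imp hc.trans hc.trans)
  clear hM hc h h1
  have step : ∃ N ε, N * signedPerm fiveCycle 1 * N⁻¹ = signedPerm fiveCycle 1 ∧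
      (N * T' * N⁻¹ = signedPerm intransitiveInvolution ε ∨
        N * T' * N⁻¹ = signedPerm transitiveInvolution ε) := by
    obtain ⟨p, ε, rfl⟩ := exists_eq_signedPerm T'
    have h2 := hr.sq
    have h3 := hr.mul_pow_three
    rw [pow_two, signedPerm_mul, signedPerm_eq_one_iff] at h2
    rw [pow_three', signedPerm_mul, signedPerm_mul, signedPerm_mul, signedPerm_eq_one_iff] at h3
    obtain ⟨r, hmem, hr'⟩ := involution_classification p h2.1 h3.1
    have hcomm : r * fiveCycle = fiveCycle * r := by
      simp only [List.mem_cons, List.not_mem_nil, or_false] at hmem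
      rcases hmem with rfl | rfl | rfl | rfl | rfl
      · simp
      · rfl
      all_goals rw [← pow_succ, ← pow_succ']
    refine ⟨signedPerm r 1, fun j => ε (r⁻¹ j), ?_, hr'.imp ?_ ?_⟩
    · rw [mul_inv_eq_iff_eq_mul, signedPerm_mul, signedPerm_mul, hcomm]
      rfl
    all_goals
      intro he
      rw [mul_inv_eq_iff_eq_mul, signedPerm_mul, signedPerm_mul, he]
      congr 1
      funext j
      simp
  obtain ⟨N, ε, hN, hT⟩ := step
  have hc := isConjPair_conj N (signedPerm fiveCycle 1) T'
  have hr2 := hr.conj N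
  rw [hN] at hc hr2
  generalize N * T' * N⁻¹ = T'' at hT hc hr2
  suffices hs : _ ∨ _ ∨ _ from hs.imp hc.trans (Or.imp hc.trans hc.trans)
  have h2 := hr2.sq
  have h3 := hr2.mul_pow_three
  rcases hT with rfl | rfl
  · left
    rw [pow_two, signedPerm_mul, signedPerm_eq_one_iff] at h2
    rw [pow_three', signedPerm_mul, signedPerm_mul, signedPerm_mul, signedPerm_eq_one_iff] at h3
    have : ε = 1 := funext <| intransitive_signs ε (congrFun h2.2) fun j => by
      simpa [mul_assoc] using congrFun h3.2 j
    rw [this]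
    exact IsConjPair.refl _ _
  · right
    rw [pow_two, signedPerm_mul, signedPerm_eq_one_iff] at h2
    rw [pow_three', signedPerm_mul, signedPerm_mul, signedPerm_mul, signedPerm_eq_one_iff] at h3
    have hfix : signedPerm 1 lastSign * signedPerm fiveCycle 1 =
        signedPerm fiveCycle 1 * signedPerm 1 lastSign := by
      rw [signedPerm_mul, signedPerm_mul, one_mul, mul_one]
      congr 1
      decide
    rcases transitive_signs ε (congrFun h2.2) (fun j => by
      simpa [mul_assoc] using congrFun h3.2 j) with (h | h) | (h | h)
    · left
      rw [show ε = 1 from funext h]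
      exact IsConjPair.refl _ _
    · right
      rw [show ε = crystallographicSigns from funext h]
      exact IsConjPair.refl _ _
    · left
      refine ⟨signedPerm 1 lastSign, hfix, ?_⟩
      rw [signedPerm_mul, signedPerm_mul, one_mul, mul_one]
      congr 1
      funext j
      simpa using h j
    · right
      refine ⟨signedPerm 1 lastSign, hfix, ?_⟩
      rw [signedPerm_mul, signedPerm_mul, one_mul, mul_one]
      congr 1
      funext j
      simpa using h j

/-! ### Dimensions of minimal stable subspaces for the unsigned normal forms -/

/-- The natural action of `B_6` on `ℝ⁶`. -/
noncomputable abbrev naturalRep : Representation ℝ (hyperoctahedralGroup 6) (Fin 6 → ℝ) :=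
  realRep (MonoidHom.id (hyperoctahedralGroup 6))

theorem naturalRep_signedPerm (p : Perm (Fin 6)) (ε : Fin 6 → ℤˣ) (w : Fin 6 → ℝ) (i : Fin 6) :
    naturalRep (signedPerm p ε) w i = ((ε (p⁻¹ i) : ℤ) : ℝ) * w (p⁻¹ i) := by
  change (((signedPerm p ε).1.map fun k : ℤ => (k : ℝ)) *ᵥ w) i = _
  rw [Matrix.mulVec, dotProduct, Finset.sum_eq_single (p⁻¹ i)]
  · simp [signedPerm_apply]
  · intro j _ hj
    have : i ≠ p j := fun h => hj (by rw [h]; simp)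
    simp [signedPerm_apply, this]
  · simp

theorem naturalRep_fiveCycle (w : Fin 6 → ℝ) :
    naturalRep (signedPerm fiveCycle 1) w = ![w 4, w 0, w 1, w 2, w 3, w 5] := by
  have h : ∀ i, fiveCycle⁻¹ i = ![4, 0, 1, 2, 3, 5] i := by decide +kernel
  ext i
  rw [naturalRep_signedPerm, h]
  fin_cases i <;> simp

theorem naturalRep_intransitiveInvolution (w : Fin 6 → ℝ) :
    naturalRep (signedPerm intransitiveInvolution 1) w = ![w 4, w 1, w 3, w 2, w 0, w 5] := by
  have h : ∀ i, intransitiveInvolution⁻¹ i = ![4, 1, 3, 2, 0, 5] i := by decide +kernel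
  ext i
  rw [naturalRep_signedPerm, h]
  fin_cases i <;> simp

theorem naturalRep_transitiveInvolution (w : Fin 6 → ℝ) :
    naturalRep (signedPerm transitiveInvolution 1) w = ![w 5, w 4, w 2, w 3, w 1, w 0] := by
  have h : ∀ i, transitiveInvolution⁻¹ i = ![5, 4, 2, 3, 1, 0] i := by decide +kernel
  ext i
  rw [naturalRep_signedPerm, h]
  fin_cases i <;> simp

/-- The submodule `W` is stable under both operators. -/
def IsStable {V : Type*} [AddCommGroup V] [Module ℝ V] (a b : V →ₗ[ℝ] V)
    (W : Submodule ℝ V) : Prop :=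
  ∀ w ∈ W, a w ∈ W ∧ b w ∈ W

/-- The submodule `W` is stable under both operators and minimal with this property. -/
structure IsMinimalStable {V : Type*} [AddCommGroup V] [Module ℝ V] (a b : V →ₗ[ℝ] V)
    (W : Submodule ℝ V) : Prop where
  stable : IsStable a b W
  minimal : ∀ U ≤ W, IsStable a b U → U = ⊥ ∨ U = W

theorem IsMinimalStable.finrank_le_one {V : Type*} [AddCommGroup V] [Module ℝ V]
    {a b : V →ₗ[ℝ] V} {W : Submodule ℝ V} (h : IsMinimalStable a b W)
    (hfix : ∀ w ∈ W, a w = w ∧ b w = w) : Module.finrank ℝ W ≤ 1 := by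
  by_cases hW : W = ⊥
  · rw [hW, finrank_bot]
    exact zero_le_one
  obtain ⟨w, hw, hw0⟩ := Submodule.exists_mem_ne_zero_of_ne_bot hW
  have hle : ℝ ∙ w ≤ W := (Submodule.span_singleton_le_iff_mem w W).2 hw
  rcases h.minimal (ℝ ∙ w) hle (fun u hu => by
    rw [(hfix u (hle hu)).1, (hfix u (hle hu)).2]; exact ⟨hu, hu⟩) with h' | h'
  · exact absurd (Submodule.span_singleton_eq_bot.1 h') hw0
  · rw [← h', finrank_span_singleton hw0]

/-- Successive shifts of e_0 - e_1 under the 5-cycle give four independent differences e_i -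
e_(i+1). -/
theorem four_le_finrank {W : Submodule ℝ (Fin 6 → ℝ)}
    (hS : ∀ w ∈ W, naturalRep (signedPerm fiveCycle 1) w ∈ W)
    (h : ![1, -1, 0, 0, 0, 0] ∈ W) : 4 ≤ Module.finrank ℝ W := by
  have h1 : ![0, 1, -1, 0, 0, 0] ∈ W := by
    have := hS _ h
    rw [naturalRep_fiveCycle] at this
    simpa using this
  have h2 : ![0, 0, 1, -1, 0, 0] ∈ W := by
    have := hS _ h1
    rw [naturalRep_fiveCycle] at this
    simpa using this
  have h3 : ![0, 0, 0, 1, -1, 0] ∈ W := by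
    have := hS _ h2
    rw [naturalRep_fiveCycle] at this
    simpa using this
  let v : Fin 4 → W := ![⟨_, h⟩, ⟨_, h1⟩, ⟨_, h2⟩, ⟨_, h3⟩]
  have hv : LinearIndependent ℝ v := by
    rw [Fintype.linearIndependent_iff]
    intro c hc
    have hc' := congrArg Subtype.val hc
    simp only [Fin.sum_univ_four, v] at hc'
    have e (i : Fin 6) := congrFun hc' i
    have e0 := e 0
    have e1 := e 1
    have e2 := e 2
    have e3 := e 3
    simp at e0 e1 e2 e3
    intro i
    fin_cases i <;> simp <;> linarith
  simpa using hv.fintype_card_le_finrank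

/-- Either the first five coordinates agree throughout W, and the action on W is trivial, or
averaging over a Klein four-group produces e_0 - e_1 in W. -/
theorem finrank_of_intransitive {W : Submodule ℝ (Fin 6 → ℝ)}
    (h : IsMinimalStable (naturalRep (signedPerm fiveCycle 1))
      (naturalRep (signedPerm intransitiveInvolution 1)) W) :
    Module.finrank ℝ W ≤ 1 ∨ 4 ≤ Module.finrank ℝ W := by
  have hS : ∀ w ∈ W, ![w 4, w 0, w 1, w 2, w 3, w 5] ∈ W := fun w hw => by
    rw [← naturalRep_fiveCycle]
    exact (h.stable w hw).1
  have hT : ∀ w ∈ W, ![w 4, w 1, w 3, w 2, w 0, w 5] ∈ W := fun w hw => by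
    rw [← naturalRep_intransitiveInvolution]
    exact (h.stable w hw).2
  by_cases heq : ∀ w ∈ W, w 0 = w 1
  · left
    apply h.finrank_le_one
    intro w hw
    have e0 := heq _ hw
    have e1 := heq _ (hS _ hw)
    have e2 := heq _ (hS _ (hS _ hw))
    have e3 := heq _ (hS _ (hS _ (hS _ hw)))
    simp at e1 e2 e3
    rw [naturalRep_fiveCycle, naturalRep_intransitiveInvolution]
    constructor <;> ext i <;> fin_cases i <;> simp <;> linarith
  · right
    push Not at heq
    obtain ⟨w, hw, hne⟩ := heq
    apply four_le_finrank fun w hw => (h.stable w hw).1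
    -- `hx` and `hy` give commuting double transpositions of the letters 1, 2, 3, 4, which generate
    -- a Klein four-group fixing 0 and 5.
    have hS' : ∀ w ∈ W, ![w 1, w 2, w 3, w 4, w 0, w 5] ∈ W := fun w hw => by
      simpa using hS _ (hS _ (hS _ (hS _ hw)))
    have hx : ∀ w ∈ W, ![w 0, w 2, w 1, w 4, w 3, w 5] ∈ W := fun w hw => by
      simpa using hS' _ (hT _ (hS _ hw))
    have hr : ∀ w ∈ W, ![w 0, w 4, w 1, w 3, w 2, w 5] ∈ W := fun w hw => by
      simpa using hS _ (hT _ hw)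
    have hy : ∀ w ∈ W, ![w 0, w 3, w 4, w 1, w 2, w 5] ∈ W := fun w hw => by
      simpa using hr _ (hx _ (hr _ (hr _ hw)))
    -- With a = w 0 - w 1, this difference has first entry a, last entry 0 and coordinate sum 0.
    -- Summing over the four-group gives (4a, -a, -a, -a, -a, 0), and subtracting its shift leaves
    -- 5a(e_0 - e_1).
    have hu := W.sub_mem hw (hS' w hw)
    have hu2 := W.add_mem hu (hy _ hu)
    have hu3 := W.add_mem hu2 (hx _ hu2)
    have hne' : 5 * (w 0 - w 1) ≠ 0 := mul_ne_zero (by norm_num) (sub_ne_zero.2 hne)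
    rw [← W.smul_mem_iff hne']
    convert W.sub_mem hu3 (hS _ hu3) using 1
    ext i
    fin_cases i <;> simp [Matrix.vecHead, Matrix.vecTail] <;> ring

/-- Either all six coordinates agree throughout W, and the action on W is trivial, or averaging over
the 5-cycle produces e_0 - e_1 in W. -/
theorem finrank_of_transitive {W : Submodule ℝ (Fin 6 → ℝ)}
    (h : IsMinimalStable (naturalRep (signedPerm fiveCycle 1))
      (naturalRep (signedPerm transitiveInvolution 1)) W) :
    Module.finrank ℝ W ≤ 1 ∨ 4 ≤ Module.finrank ℝ W := by
  have hS : ∀ w ∈ W, ![w 4, w 0, w 1, w 2, w 3, w 5] ∈ W := fun w hw => by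
    rw [← naturalRep_fiveCycle]
    exact (h.stable w hw).1
  have hT : ∀ w ∈ W, ![w 5, w 4, w 2, w 3, w 1, w 0] ∈ W := fun w hw => by
    rw [← naturalRep_transitiveInvolution]
    exact (h.stable w hw).2
  by_cases heq : ∀ w ∈ W, w 0 = w 5
  · left
    apply h.finrank_le_one
    intro w hw
    have e0 := heq _ hw
    have e1 := heq _ (hS _ hw)
    have e2 := heq _ (hS _ (hS _ hw))
    have e3 := heq _ (hS _ (hS _ (hS _ hw)))
    have e4 := heq _ (hS _ (hS _ (hS _ (hS _ hw))))
    simp at e1 e2 e3 e4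
    rw [naturalRep_fiveCycle, naturalRep_transitiveInvolution]
    constructor <;> ext i <;> fin_cases i <;> simp <;> linarith
  · right
    push Not at heq
    obtain ⟨w, hw, hne⟩ := heq
    apply four_le_finrank fun w hw => (h.stable w hw).1
    -- With a = w 0 - w 5, the sum of the five shifts of this vector is (a, a, a, a, a, -5a).
    -- Subtracting its image under T gives 6a(e_0 - e_5), and subtracting the shift of that gives
    -- 6a(e_0 - e_1).
    have hu := W.sub_mem hw (hT w hw)
    have hu1 := hS _ hu
    have hu2 := hS _ hu1
    have hu3 := hS _ hu2
    have hu4 := hS _ hu3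
    have hs := W.add_mem hu (W.add_mem hu1 (W.add_mem hu2 (W.add_mem hu3 hu4)))
    have hd := W.sub_mem hs (hT _ hs)
    have hne' : 6 * (w 0 - w 5) ≠ 0 := mul_ne_zero (by norm_num) (sub_ne_zero.2 hne)
    rw [← W.smul_mem_iff hne']
    convert W.sub_mem hd (hS _ hd) using 1
    ext i
    fin_cases i <;> simp [Matrix.vecHead, Matrix.vecTail] <;> ring

theorem IsMinimalStable.map {V : Type*} [AddCommGroup V] [Module ℝ V] {a b a' b' : V →ₗ[ℝ] V}
    {W : Submodule ℝ V} (h : IsMinimalStable a b W) (e : V ≃ₗ[ℝ] V)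
    (ha : ∀ v, e (a v) = a' (e v)) (hb : ∀ v, e (b v) = b' (e v)) :
    IsMinimalStable a' b' (W.map e.toLinearMap) where
  stable := by
    rintro _ ⟨w, hw, rfl⟩
    exact ⟨⟨a w, (h.stable w hw).1, ha w⟩, ⟨b w, (h.stable w hw).2, hb w⟩⟩
  minimal := by
    intro U hU hst
    have hle : U.comap e.toLinearMap ≤ W := by
      intro v hv
      obtain ⟨w, hw, hwv⟩ := hU hv
      rwa [← e.injective hwv]
    have hmap : (U.comap e.toLinearMap).map e.toLinearMap = U :=
      Submodule.map_comap_eq_of_surjective e.surjective U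
    refine (h.minimal _ hle fun v hv => ?_).imp (fun h' => ?_) fun h' => ?_
    · have := hst (e v) hv
      rw [← ha, ← hb] at this
      exact this
    · rw [← hmap, h', Submodule.map_bot]
    · rw [← hmap, h']

/-- The linear automorphism of `ℝ⁶` given by an element of `B_6`. -/
noncomputable def naturalEquiv (M : hyperoctahedralGroup 6) : (Fin 6 → ℝ) ≃ₗ[ℝ] (Fin 6 → ℝ) :=
  LinearEquiv.ofLinearMap (naturalRep M) (naturalRep M⁻¹)
    (by rw [← Module.End.mul_eq_comp, ← map_mul, mul_inv_cancel, map_one]; rfl)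
    (by rw [← Module.End.mul_eq_comp, ← map_mul, inv_mul_cancel, map_one]; rfl)

theorem naturalEquiv_apply_comm {M S S' : hyperoctahedralGroup 6} (h : M * S = S' * M)
    (v : Fin 6 → ℝ) : naturalEquiv M (naturalRep S v) = naturalRep S' (naturalEquiv M v) := by
  change (naturalRep M * naturalRep S) v = (naturalRep S' * naturalRep M) v
  rw [← map_mul, ← map_mul, h]

theorem IsMinimalStable.exists_of_isConjPair {S T S' T' : hyperoctahedralGroup 6}
    {W : Submodule ℝ (Fin 6 → ℝ)} (h : IsMinimalStable (naturalRep S) (naturalRep T) W)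
    (hc : IsConjPair S T S' T') :
    ∃ W' : Submodule ℝ (Fin 6 → ℝ), IsMinimalStable (naturalRep S') (naturalRep T') W' ∧
      Module.finrank ℝ W' = Module.finrank ℝ W := by
  obtain ⟨M, hS, hT⟩ := hc
  exact ⟨_, h.map (naturalEquiv M) (naturalEquiv_apply_comm hS) (naturalEquiv_apply_comm hT),
    LinearEquiv.finrank_map_eq _ _⟩

/-! ### From the generators to the whole group -/

/-- The generators have finite order, so their inverses are positive powers and no inverse step is
needed. Proving the claim for g and its inverse together carries the closure induction. -/
theorem icosahedralGroup_induction {P : icosahedralGroup → Prop} (hone : P 1)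
    (hmul : ∀ g h, P g → P h → P (g * h)) (hs : P fiveFold) (ht : P twoFold)
    (g : icosahedralGroup) : P g := by
  have hpow : ∀ n : ℕ, P (fiveFold ^ n) := by
    intro n
    induction n with
    | zero => simpa using hone
    | succ n ih => rw [pow_succ]; exact hmul _ _ ih hs
  have hsinv : fiveFold⁻¹ = fiveFold ^ 4 := by
    rw [inv_eq_iff_mul_eq_one, ← pow_succ', fiveFold_pow_five]
  have htinv : twoFold⁻¹ = twoFold := by
    rw [inv_eq_iff_mul_eq_one, ← pow_two, twoFold_sq]
  have hg : g ∈ Subgroup.closure {fiveFold, twoFold} := by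
    rw [closure_fiveFold_twoFold]
    exact Subgroup.mem_top g
  have key : P g ∧ P g⁻¹ := by
    induction hg using Subgroup.closure_induction with
    | mem x hx =>
      rcases hx with rfl | rfl
      · exact ⟨hs, hsinv ▸ hpow 4⟩
      · exact ⟨ht, htinv.symm ▸ ht⟩
    | one => exact ⟨hone, by simpa using hone⟩
    | mul x y _ _ hx hy => exact ⟨hmul _ _ hx.1 hy.1, by rw [mul_inv_rev]; exact hmul _ _ hy.2 hx.2⟩
    | inv x _ hx => exact ⟨hx.2, by rw [inv_inv]; exact hx.1⟩
  exact key.1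

/-- A subspace stable under the two generators is stable under the whole group, hence a
subrepresentation. -/
theorem isMinimalStable_of_isIrreducible {ρ : icosahedralGroup →* hyperoctahedralGroup 6}
    (W : Subrepresentation (realRep ρ)) (hW : W.toRepresentation.IsIrreducible) :
    IsMinimalStable (naturalRep (ρ fiveFold)) (naturalRep (ρ twoFold)) W.toSubmodule where
  stable := fun _ hw =>
    ⟨W.apply_mem_toSubmodule fiveFold hw, W.apply_mem_toSubmodule twoFold hw⟩
  minimal := by
    intro U hU hst
    have hinv : ∀ g : icosahedralGroup, ∀ u ∈ U, realRep ρ g u ∈ U := by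
      intro g
      induction g using icosahedralGroup_induction with
      | hone => intro u hu; rwa [map_one]
      | hmul g h hg hh => intro u hu; rw [map_mul]; exact hg _ (hh u hu)
      | hs => exact fun u hu => (hst u hu).1
      | ht => exact fun u hu => (hst u hu).2
    let U' : Subrepresentation W.toRepresentation :=
      ⟨U.comap W.toSubmodule.subtype, fun g v hv => hinv g _ hv⟩
    have hmap : (U.comap W.toSubmodule.subtype).map W.toSubmodule.subtype = U := by
      rw [Submodule.map_comap_subtype, inf_eq_right.2 hU]
    rcases hW.eq_bot_or_eq_top U' with h | h
    · left
      have h' : U.comap W.toSubmodule.subtype = ⊥ := congrArg Subrepresentation.toSubmodule h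
      rw [← hmap, h', Submodule.map_bot]
    · right
      have h' : U.comap W.toSubmodule.subtype = ⊤ := congrArg Subrepresentation.toSubmodule h
      rw [← hmap, h', Submodule.map_top, Submodule.range_subtype]

theorem isConjPair_of_isCrystallographic {ρ : icosahedralGroup →* hyperoctahedralGroup 6}
    (hρ : IsCrystallographic (realRep ρ)) :
    IsConjPair (ρ fiveFold) (ρ twoFold) (signedPerm fiveCycle 1)
      (signedPerm transitiveInvolution crystallographicSigns) := by
  obtain ⟨-, -, W, hdim, hW⟩ := hρ
  have hmin := isMinimalStable_of_isIrreducible W hW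
  have hrel : IcosahedralRelations (ρ fiveFold) (ρ twoFold) :=
    ⟨by rw [← map_pow, fiveFold_pow_five, map_one], by rw [← map_pow, twoFold_sq, map_one],
      by rw [← map_mul, ← map_pow, fiveFold_mul_twoFold_pow_three, map_one]⟩
  by_cases h1 : ρ fiveFold = 1
  · exfalso
    -- With S trivial, T satisfies both T^3 = 1 and T^2 = 1.
    have ht : ρ twoFold = 1 := by
      have h3 := hrel.mul_pow_three
      rwa [h1, one_mul, pow_succ, hrel.sq, one_mul] at h3
    have := hmin.finrank_le_one fun w _ => by
      rw [h1, ht, map_one]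
      exact ⟨rfl, rfl⟩
    omega
  · rcases isConjPair_normalForm hrel h1 with hc | hc | hc
    · obtain ⟨W', hW', he⟩ := hmin.exists_of_isConjPair hc
      have := finrank_of_intransitive hW'
      omega
    · obtain ⟨W', hW', he⟩ := hmin.exists_of_isConjPair hc
      have := finrank_of_transitive hW'
      omega
    · exact hc

/-- Both generator pairs are conjugate to the same normal form, and a matrix intertwining the
generators intertwines every group element. -/
theorem exists_conj_of_isCrystallographic {ρ₁ ρ₂ : icosahedralGroup →* hyperoctahedralGroup 6}
    (h₁ : IsCrystallographic (realRep ρ₁)) (h₂ : IsCrystallographic (realRep ρ₂)) :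
    ∃ M : hyperoctahedralGroup 6, ∀ g : icosahedralGroup, ρ₁ g = M * ρ₂ g * M⁻¹ := by
  obtain ⟨M, hs, ht⟩ :=
    (isConjPair_of_isCrystallographic h₂).trans (isConjPair_of_isCrystallographic h₁).symm
  refine ⟨M, fun g => ?_⟩
  induction g using icosahedralGroup_induction with
  | hone => simp
  | hmul g h hg hh => rw [map_mul, map_mul, hg, hh]; group
  | hs => rw [hs, mul_inv_cancel_right]
  | ht => rw [ht, mul_inv_cancel_right]

end Icosahedral

/-! ### Conjugacy of representations and of their image subgroups -/

theorem mainTheorem2 :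
    (∀ ρ₁ ρ₂ : Icosahedral.icosahedralGroup →* Icosahedral.hyperoctahedralGroup 6,
      Icosahedral.IsCrystallographic (Icosahedral.realRep ρ₁) →
      Icosahedral.IsCrystallographic (Icosahedral.realRep ρ₂) →
      ∃ M : Icosahedral.hyperoctahedralGroup 6,
        ∀ g : Icosahedral.icosahedralGroup, ρ₁ g = M * ρ₂ g * M⁻¹) ∧
    (∀ H₁ H₂ : Subgroup (Icosahedral.hyperoctahedralGroup 6),
      Icosahedral.IsCrystallographicSubgroup H₁ →
      Icosahedral.IsCrystallographicSubgroup H₂ →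
      ∃ M : Icosahedral.hyperoctahedralGroup 6,
        H₁ = H₂.map (MulAut.conj M).toMonoidHom) := by
  refine ⟨fun ρ₁ ρ₂ h₁ h₂ => Icosahedral.exists_conj_of_isCrystallographic h₁ h₂, ?_⟩
  rintro H₁ H₂ ⟨e₁, h₁⟩ ⟨e₂, h₂⟩
  -- The isomorphisms followed by the inclusions are homomorphisms with images `H₁` and `H₂`, so a
  -- matrix conjugating one homomorphism to the other conjugates the images.
  obtain ⟨M, hM⟩ := Icosahedral.exists_conj_of_isCrystallographic h₁ h₂
  have hM' : ∀ g, (e₁ g : Icosahedral.hyperoctahedralGroup 6) = M * (e₂ g).1 * M⁻¹ := hM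
  refine ⟨M, Subgroup.ext fun x => ⟨fun hx => ?_, ?_⟩⟩
  · refine ⟨(e₂ (e₁.symm ⟨x, hx⟩)).1, (e₂ (e₁.symm ⟨x, hx⟩)).2, ?_⟩
    have h := hM' (e₁.symm ⟨x, hx⟩)
    rw [MulEquiv.apply_symm_apply] at h
    exact h.symm
  · rintro ⟨y, hy, rfl⟩
    have h := hM' (e₂.symm ⟨y, hy⟩)
    rw [MulEquiv.apply_symm_apply] at h
    change M * y * M⁻¹ ∈ H₁
    rw [← h]
    exact (e₁ _).2
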